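/- Let $F_3$ be the free group on three generators $a_1,a_2,a_3$, and let $T$ be its usual Cayley graph: the vertices are the elements of $F_3$, and $u,v\in F_3$ are adjacent if and only if $v=ua_i$ or $u=va_i$ for some $i\in\{1,2,3\}$. Thus $T$ is the $6$-regular tree. Regard $F_3$ as a subgroup of the group $\operatorname{Aut}(T)$ of graph automorphisms of $T$ through its action on $T$ by left multiplication, and equip $\operatorname{Aut}(T)$ with the topology of pointwise convergence on the (discrete) set of vertices of $T$. Then the commensurator of $F_3$ in $\operatorname{Aut}(T)$, $$\operatorname{Comm}_{\operatorname{Aut}(T)}(F_3)=\{g\in\operatorname{Aut}(T) \mid F_3\cap gF_3g^{-1}\text{ has finite index in both } F_3 \text{ and } gF_3g^{-1}\},$$ is dense in $\operatorname{Aut}(T)$. -/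

import Mathlib

/-- The usual Cayley graph of the free group on `α`: the vertices are the elements of the group, and
`u`, `v` are adjacent when `v = u * s` or `u = v * s` for a free generator `s`. For `α = Fin 3` it
is the `6`-regular tree. -/
def freeGroupCayleyTree (α : Type*) : SimpleGraph (FreeGroup α) :=
  SimpleGraph.mulCayley (Set.range FreeGroup.of)

/-- The topology of pointwise convergence on the vertices (which carry the discrete topology) on the
automorphism group of a graph: the usual permutation topology. -/
instance graphAutTopology {V : Type*} (G : SimpleGraph V) : TopologicalSpace (G ≃g G) :=
  TopologicalSpace.induced (fun f : G ≃g G => (f : V → V))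
    (@Pi.topologicalSpace V (fun _ => V) (fun _ => ⊥))

/-- The action of the free group on its Cayley tree by left multiplication. -/
def freeGroupLeftAction (α : Type*) :
    FreeGroup α →* (freeGroupCayleyTree α ≃g freeGroupCayleyTree α) where
  toFun g :=
    { toEquiv := Equiv.mulLeft g
      map_rel_iff' := SimpleGraph.mulCayley_adj_mul_iff_right }
  map_one' := by
    ext x
    exact one_mul x
  map_mul' g h := by
    ext x
    exact mul_assoc g h x

open scoped Pointwise

/-! Density means matching any automorphism `g` on a finite set of vertices, which is enlarged to a
finite prefix-closed set `B`. Up to a translation, `g` is determined by the permutations `σ u` of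
letters that it induces at the vertices. `exists_relabeling_extending` realizes `σ` on `B` inside a
finite set with a right action of the free group, each point carrying a permutation of letters
compatible with edge reversal. Relabeling paths from a base point gives an automorphism that agrees
with `g` on the finite set after translation. It commensurates the free group: it conjugates the
finite-index stabilizer of the base point into the free group, and so does its inverse for the dual
data. -/

theorem Equiv.exists_extend_of_fiberwise {X Y : Type*} [Finite X] (c d : X → Y) (e₀ : X ≃ X)
    (he₀ : ∀ x, d (e₀ x) = c x) (P : Set X) (f : X → X) (hf : Set.InjOn f P)
    (hfc : ∀ x ∈ P, d (f x) = c x) :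
    ∃ e : X ≃ X, (∀ x, d (e x) = c x) ∧ ∀ x ∈ P, e x = f x := by
  classical
  have := Fintype.ofFinite X
  have key (y : Y) : ∃ e : {x // c x = y} ≃ {x // d x = y}, ∀ x, x.1 ∈ P → (e x).1 = f x.1 := by
    have hcard : Fintype.card {x // c x = y} = (Finset.univ.filter fun x => d x = y).card := by
      rw [← Fintype.card_subtype]
      exact Fintype.card_congr (e₀.subtypeEquiv fun x => by rw [he₀])
    obtain ⟨g, hg⟩ := Set.MapsTo.exists_equiv_extend_of_card_eq hcard
      (s := {x : {x // c x = y} | x.1 ∈ P}) (f := fun x => f x.1)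
      (fun x hx => by simpa [hfc x.1 hx] using x.2)
      (fun x hx x' hx' h => Subtype.ext (hf hx hx' h))
    exact ⟨g.trans (Equiv.subtypeEquivRight fun x => by simp), fun x hx => hg x hx⟩
  choose e he using key
  exact ⟨Equiv.ofFiberEquiv e, Equiv.ofFiberEquiv_map e, fun x hx => he _ ⟨x, rfl⟩ hx⟩

namespace FreeGroup

variable {α : Type*}

/-- The formal inverse of a letter. -/
def flipLetter (s : α × Bool) : α × Bool := (s.1, !s.2)

@[simp]
theorem flipLetter_flipLetter (s : α × Bool) : flipLetter (flipLetter s) = s := by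
  simp [flipLetter]

theorem mk_flipLetter (s : α × Bool) : mk [flipLetter s] = (mk [s])⁻¹ := by
  simp [inv_mk, invRev, flipLetter]

theorem mk_append_singleton (L : List (α × Bool)) (s : α × Bool) :
    mk (L ++ [s]) = mk L * mk [s] :=
  mul_mk.symm

theorem mk_singleton_injective : Function.Injective fun s : α × Bool => mk [s] := by
  classical
  intro s t h
  have := congrArg toWord h
  simpa [toWord_mk, reduce.cons] using this

theorem induction_mul_letter {C : FreeGroup α → Prop} (u : FreeGroup α) (one : C 1)
    (mul : ∀ u s, C u → C (u * mk [s])) : C u := by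
  induction u using Quot.inductionOn with
  | h L =>
    induction L using List.reverseRecOn with
    | nil => exact one
    | append_singleton L s ih =>
      have := mul _ s ih
      rwa [quot_mk_eq_mk, ← mk_append_singleton] at this

theorem mul_letter_ne_self (u : FreeGroup α) (s : α × Bool) : u * mk [s] ≠ u := by
  classical
  intro h
  have := congrArg toWord (mul_eq_left.mp h)
  simp [toWord_mk, reduce.cons] at this

end FreeGroup

open FreeGroup

theorem freeGroupCayleyTree_adj_iff {α : Type*} {u v : FreeGroup α} :
    (freeGroupCayleyTree α).Adj u v ↔ ∃ s : α × Bool, v = u * FreeGroup.mk [s] := by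
  rw [freeGroupCayleyTree, SimpleGraph.mulCayley_adj']
  constructor
  · rintro ⟨-, -, ⟨a, rfl⟩, h | h⟩
    · exact ⟨(a, true), h.symm⟩
    · refine ⟨flipLetter (a, true), ?_⟩
      rw [mk_flipLetter, h]
      exact (mul_inv_cancel_right _ _).symm
  · rintro ⟨⟨a, b⟩, rfl⟩
    refine ⟨(mul_letter_ne_self _ _).symm, of a, ⟨a, rfl⟩, ?_⟩
    cases b
    · right
      rw [show (a, false) = flipLetter (a, true) from rfl, mk_flipLetter]
      exact (inv_mul_cancel_right _ _).symm
    · exact Or.inl rfl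

theorem freeGroupLeftAction_apply {α : Type*} (k u : FreeGroup α) :
    freeGroupLeftAction α k u = k * u :=
  rfl

/-! ### Finite relabeling data and commensuration -/

/-- A right action of the free group on `X`, given by the letters, together with a permutation of
the letters at each point that is compatible with reversing edges. -/
structure Relabeling (α X : Type*) where
  /-- The action of a letter. -/
  step : α × Bool → X → X
  /-- The permutation of the letters at a point. -/
  perm : X → Equiv.Perm (α × Bool)
  step_flip : ∀ s x, step (flipLetter s) (step s x) = x
  perm_step : ∀ s x, perm (step s x) (flipLetter s) = flipLetter (perm x s)

namespace Relabeling

variable {α X : Type*} (D : Relabeling α X)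

/-- The relabeling with the old and the new labels exchanged. -/
def dual : Relabeling α X where
  step t x := D.step ((D.perm x).symm t) x
  perm x := (D.perm x).symm
  step_flip t x := by
    have h := D.perm_step ((D.perm x).symm t) x
    rw [Equiv.apply_symm_apply] at h
    rw [← h, Equiv.symm_apply_apply, D.step_flip]
  perm_step t x := by
    have h := D.perm_step ((D.perm x).symm t) x
    rw [Equiv.apply_symm_apply] at h
    rw [← h, Equiv.symm_apply_apply]

theorem dual_dual : D.dual.dual = D := by
  simp [dual]

/-- Crossing the edge with a given old label, the second coordinate recording the new labels. -/
def move (s : α × Bool) (z : X × FreeGroup α) : X × FreeGroup α :=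
  (D.step s z.1, z.2 * FreeGroup.mk [D.perm z.1 s])

theorem move_flip (s : α × Bool) (z : X × FreeGroup α) :
    D.move (flipLetter s) (D.move s z) = z := by
  simp [move, D.step_flip, D.perm_step, mk_flipLetter, -inv_mk]

/-- Crossing an edge as a permutation. -/
def moveEquiv (s : α × Bool) : Equiv.Perm (X × FreeGroup α) where
  toFun := D.move s
  invFun := D.move (flipLetter s)
  left_inv := D.move_flip s
  right_inv z := by simpa using D.move_flip (flipLetter s) z

/-- The left action of the free group obtained by moving along the inverse of a word. -/
def moveHom : FreeGroup α →* Equiv.Perm (X × FreeGroup α) :=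
  FreeGroup.lift fun a => (D.moveEquiv (a, true))⁻¹

/-- The end of the path that starts at `z` and follows a word in the old labels. -/
def walk (u : FreeGroup α) (z : X × FreeGroup α) : X × FreeGroup α :=
  D.moveHom u⁻¹ z

theorem walk_one (z : X × FreeGroup α) : D.walk 1 z = z := by
  simp [walk]

theorem walk_mul (u v : FreeGroup α) (z : X × FreeGroup α) :
    D.walk (u * v) z = D.walk v (D.walk u z) := by
  simp [walk]

theorem walk_letter (s : α × Bool) (z : X × FreeGroup α) :
    D.walk (FreeGroup.mk [s]) z = D.move s z := by
  rcases s with ⟨a, b⟩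
  cases b <;> simp [walk, moveHom, inv_mk, invRev] <;> rfl

/-- The action of the free group on the points. -/
def point (x : X) (u : FreeGroup α) : X := (D.walk u (x, 1)).1

/-- The map on the tree that relabels the paths starting at the identity. -/
def relabel (x : X) (u : FreeGroup α) : FreeGroup α := (D.walk u (x, 1)).2

@[simp]
theorem point_one (x : X) : D.point x 1 = x := by
  simp [point, walk_one]

@[simp]
theorem relabel_one (x : X) : D.relabel x 1 = 1 := by
  simp [relabel, walk_one]

theorem point_mul_letter (x : X) (u : FreeGroup α) (s : α × Bool) :
    D.point x (u * FreeGroup.mk [s]) = D.step s (D.point x u) := by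
  simp [point, walk_mul, walk_letter, move]

theorem relabel_mul_letter (x : X) (u : FreeGroup α) (s : α × Bool) :
    D.relabel x (u * FreeGroup.mk [s]) =
      D.relabel x u * FreeGroup.mk [D.perm (D.point x u) s] := by
  simp [relabel, point, walk_mul, walk_letter, move]

theorem point_mul (x : X) (u v : FreeGroup α) :
    D.point x (u * v) = D.point (D.point x u) v := by
  induction v using induction_mul_letter with
  | one => simp
  | mul v s ih => rw [← mul_assoc, point_mul_letter, ih, point_mul_letter]

theorem relabel_mul (x : X) (u v : FreeGroup α) :
    D.relabel x (u * v) = D.relabel x u * D.relabel (D.point x u) v := by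
  induction v using induction_mul_letter with
  | one => simp
  | mul v s ih =>
    rw [← mul_assoc, relabel_mul_letter, ih, relabel_mul_letter, point_mul, mul_assoc]

/-- Old and new labels describe the same path in `X`, so reading the new word in the dual recovers
the old one. -/
theorem dual_relabel_and_point (x : X) (u : FreeGroup α) :
    D.dual.relabel x (D.relabel x u) = u ∧ D.dual.point x (D.relabel x u) = D.point x u := by
  induction u using induction_mul_letter with
  | one => simp
  | mul u s ih =>
    rw [relabel_mul_letter, relabel_mul_letter, point_mul_letter, point_mul_letter, ih.1, ih.2]
    simp [dual]

theorem relabel_dual_relabel (x : X) (u : FreeGroup α) :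
    D.relabel x (D.dual.relabel x u) = u := by
  have h := (D.dual.dual_relabel_and_point x u).1
  rwa [dual_dual] at h

theorem relabel_adj (x : X) {u v : FreeGroup α} (h : (freeGroupCayleyTree α).Adj u v) :
    (freeGroupCayleyTree α).Adj (D.relabel x u) (D.relabel x v) := by
  obtain ⟨s, rfl⟩ := freeGroupCayleyTree_adj_iff.mp h
  exact freeGroupCayleyTree_adj_iff.mpr ⟨_, D.relabel_mul_letter x u s⟩

/-- The automorphism of the tree given by a relabeling. -/
def aut (x : X) : freeGroupCayleyTree α ≃g freeGroupCayleyTree α where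
  toFun := D.relabel x
  invFun := D.dual.relabel x
  left_inv u := (D.dual_relabel_and_point x u).1
  right_inv := D.relabel_dual_relabel x
  map_rel_iff' {u v} := by
    refine ⟨fun h => ?_, D.relabel_adj x⟩
    have h' := D.dual.relabel_adj x h
    rwa [Equiv.coe_fn_mk, (D.dual_relabel_and_point x u).1,
      (D.dual_relabel_and_point x v).1] at h'

theorem aut_inv (x : X) : (D.aut x)⁻¹ = D.dual.aut x :=
  RelIso.ext fun _ => rfl

/-- The stabilizer of a point. -/
def stabilizer (x : X) : Subgroup (FreeGroup α) where
  carrier := {u | D.point x u = x}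
  one_mem' := D.point_one x
  mul_mem' {u v} hu hv := by
    simp only [Set.mem_ofPred_eq] at hu hv ⊢
    rw [point_mul, hu, hv]
  inv_mem' {u} hu := by
    simp only [Set.mem_ofPred_eq] at hu ⊢
    nth_rw 1 [← hu]
    rw [← point_mul, mul_inv_cancel, point_one]

theorem finiteIndex_stabilizer [Finite X] (x : X) : (D.stabilizer x).FiniteIndex := by
  refine Subgroup.finiteIndex_iff_finite_quotient.mpr
    (Finite.of_injective (β := X)
      -- The inverse turns left cosets into points of the orbit of a right action.
      (fun q => D.point x q.out⁻¹) fun p q h => ?_)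
  rw [← p.out_eq', ← q.out_eq']
  refine QuotientGroup.eq.mpr ?_
  change D.point x _ = x
  simp only at h
  rw [point_mul, h, ← point_mul, inv_mul_cancel, point_one]

theorem aut_mul_leftAction (x : X) {k : FreeGroup α} (hk : k ∈ D.stabilizer x) :
    D.aut x * freeGroupLeftAction α k = freeGroupLeftAction α (D.relabel x k) * D.aut x := by
  refine RelIso.ext fun u => ?_
  change D.relabel x (k * u) = D.relabel x k * D.relabel x u
  rw [relabel_mul, show D.point x k = x from hk]

theorem relIndex_conj_aut [Finite X] (x : X) :
    (freeGroupLeftAction α).range.relIndex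
      (ConjAct.toConjAct (D.aut x) • (freeGroupLeftAction α).range) ≠ 0 := by
  have hmap : ConjAct.toConjAct (D.aut x) • (freeGroupLeftAction α).range =
      Subgroup.map ((MulAut.conj (D.aut x)).toMonoidHom.comp (freeGroupLeftAction α)) ⊤ := by
    rw [MonoidHom.range_eq_map, ← Subgroup.map_map]
    rfl
  rw [hmap, ← Subgroup.relIndex_comap, Subgroup.relIndex_top_right]
  have := D.finiteIndex_stabilizer x
  have hle : D.stabilizer x ≤ Subgroup.comap
      ((MulAut.conj (D.aut x)).toMonoidHom.comp (freeGroupLeftAction α))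
      (freeGroupLeftAction α).range := fun k hk =>
    ⟨D.relabel x k, by simp [D.aut_mul_leftAction x hk]⟩
  exact (Subgroup.finiteIndex_of_le hle).index_ne_zero

theorem aut_mem_commensurator [Finite X] (x : X) :
    D.aut x ∈ Subgroup.Commensurable.commensurator (freeGroupLeftAction α).range := by
  rw [Subgroup.Commensurable.commensurator_mem_iff]
  refine ⟨?_, D.relIndex_conj_aut x⟩
  have h := D.dual.relIndex_conj_aut x
  rw [← aut_inv] at h
  -- Conjugating the bound for the inverse by `D.aut x` gives the other index.
  rw [← Subgroup.relIndex_pointwise_smul (ConjAct.toConjAct (D.aut x)), smul_smul] at h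
  simpa using h

/-- A relabeling is determined by commuting data on the free generators. -/
def ofEquiv (e : α → X ≃ X) (p : X → Equiv.Perm (α × Bool))
    (h : ∀ a x, p (e a x) (a, false) = flipLetter (p x (a, true))) : Relabeling α X where
  step s x := bif s.2 then e s.1 x else (e s.1).symm x
  perm := p
  step_flip := by rintro ⟨a, _ | _⟩ x <;> simp [flipLetter]
  perm_step := by
    rintro ⟨a, _ | _⟩ x
    · have := h a ((e a).symm x)
      rw [Equiv.apply_symm_apply] at this
      simp [this, flipLetter]
    · exact h a x

end Relabeling

theorem leftAction_mem_commensurator {α : Type*} (k : FreeGroup α) :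
    freeGroupLeftAction α k ∈
      Subgroup.Commensurable.commensurator (freeGroupLeftAction α).range := by
  rw [Subgroup.Commensurable.commensurator_mem_iff, Subgroup.conjAct_pointwise_smul_eq_self]
  exact Subgroup.le_normalizer ⟨k, rfl⟩

/-! ### Approximating an arbitrary automorphism -/

theorem exists_localPerm {α : Type*} [Finite α]
    (g : freeGroupCayleyTree α ≃g freeGroupCayleyTree α) :
    ∃ σ : FreeGroup α → Equiv.Perm (α × Bool),
      (∀ u s, g (u * FreeGroup.mk [s]) = g u * FreeGroup.mk [σ u s]) ∧
      ∀ u s, σ (u * FreeGroup.mk [s]) (flipLetter s) = flipLetter (σ u s) := by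
  have h (u : FreeGroup α) (s : α × Bool) :
      ∃ t, g (u * FreeGroup.mk [s]) = g u * FreeGroup.mk [t] :=
    freeGroupCayleyTree_adj_iff.mp (g.map_adj_iff.mpr (freeGroupCayleyTree_adj_iff.mpr ⟨s, rfl⟩))
  choose f hf using h
  have hinj (u : FreeGroup α) : Function.Injective (f u) := fun s t hst => by
    have := hf u s
    rw [hst, ← hf u t] at this
    exact mk_singleton_injective (mul_left_cancel (g.injective this))
  refine ⟨fun u => Equiv.ofBijective (f u) (Finite.injective_iff_bijective.mp (hinj u)), hf,
    fun u s => mk_singleton_injective ?_⟩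
  have h1 := hf (u * FreeGroup.mk [s]) (flipLetter s)
  rw [mk_flipLetter, mul_inv_cancel_right, hf u s, mul_assoc, left_eq_mul] at h1
  simp only [Equiv.ofBijective_apply, mk_flipLetter]
  exact eq_inv_of_mul_eq_one_right h1

/-- Pairing `B` with all permutations balances the labels: as many points demand a given label
across an edge as offer it, so the partial steps along `(σ u, u)` extend to bijections. -/
theorem exists_relabeling_extending {α : Type*} [Finite α] (B : Finset (FreeGroup α))
    (σ : FreeGroup α → Equiv.Perm (α × Bool))
    (hσ : ∀ u s, σ (u * FreeGroup.mk [s]) (flipLetter s) = flipLetter (σ u s)) :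
    ∃ D : Relabeling α (Equiv.Perm (α × Bool) × B), (∀ x, D.perm x = x.1) ∧
      ∀ (u : B) s (h : u.1 * FreeGroup.mk [s] ∈ B),
        D.step s (σ u, u) = (σ (u.1 * FreeGroup.mk [s]), ⟨u.1 * FreeGroup.mk [s], h⟩) := by
  classical
  let flip : Equiv.Perm (α × Bool) :=
    ⟨flipLetter, flipLetter, flipLetter_flipLetter, flipLetter_flipLetter⟩
  have key (a : α) : ∃ e : Equiv.Perm (α × Bool) × B ≃ Equiv.Perm (α × Bool) × B,
      (∀ x, (e x).1 (a, false) = flipLetter (x.1 (a, true))) ∧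
      ∀ (u : B) (h : u.1 * FreeGroup.mk [(a, true)] ∈ B),
        e (σ u, u) = (σ (u.1 * FreeGroup.mk [(a, true)]),
          ⟨u.1 * FreeGroup.mk [(a, true)], h⟩) := by
    obtain ⟨e, he, hP⟩ := Equiv.exists_extend_of_fiberwise
      (fun x : Equiv.Perm (α × Bool) × B => flipLetter (x.1 (a, true)))
      (fun x => x.1 (a, false))
      -- Conjugation by `flip` matches the two kinds of fibers, so they have equal size.
      (((Equiv.mulLeft flip).trans (Equiv.mulRight flip)).prodCongr (Equiv.refl B))
      (fun x => rfl)
      {x | x.1 = σ x.2 ∧ x.2.1 * FreeGroup.mk [(a, true)] ∈ B}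
      (fun x => if h : x.2.1 * FreeGroup.mk [(a, true)] ∈ B then
        (σ (x.2.1 * FreeGroup.mk [(a, true)]), ⟨x.2.1 * FreeGroup.mk [(a, true)], h⟩) else x)
      (by
        rintro ⟨p, u⟩ ⟨hp, hu⟩ ⟨q, v⟩ ⟨hq, hv⟩ h
        obtain rfl : p = σ u := hp
        obtain rfl : q = σ v := hq
        simp only [dif_pos hu, dif_pos hv, Prod.mk.injEq, Subtype.mk.injEq,
          mul_left_inj] at h
        obtain rfl := Subtype.ext h.2
        rfl)
      (by
        rintro ⟨p, u⟩ ⟨hp, hu⟩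
        obtain rfl : p = σ u := hp
        simp only [dif_pos hu]
        exact hσ u.1 (a, true))
    refine ⟨e, he, fun u h => ?_⟩
    rw [hP (σ u, u) ⟨rfl, h⟩, dif_pos h]
  choose e he hB using key
  refine ⟨Relabeling.ofEquiv e Prod.fst he, fun _ => rfl, ?_⟩
  rintro u ⟨a, _ | _⟩ h
  · change (e a).symm _ = _
    have hu : u.1 * FreeGroup.mk [(a, false)] * FreeGroup.mk [(a, true)] = u.1 := by
      rw [show (a, false) = flipLetter (a, true) from rfl, mk_flipLetter, inv_mul_cancel_right]
    have := hB a ⟨_, h⟩ (by simp only [hu, u.2])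
    simp only [hu] at this
    rw [Equiv.symm_apply_eq, this]
  · exact hB a u h

theorem exists_prefixClosed {α : Type*} (I : Finset (FreeGroup α)) :
    ∃ B : Finset (FreeGroup α), 1 ∈ B ∧
      ∀ u ∈ I, ∃ L, FreeGroup.mk L = u ∧ ∀ L', L' <+: L → FreeGroup.mk L' ∈ B := by
  classical
  refine ⟨insert 1 (I.biUnion fun u => (u.toWord.inits.map FreeGroup.mk).toFinset),
    Finset.mem_insert_self _ _, fun u hu => ⟨u.toWord, mk_toWord, fun L' hL' => ?_⟩⟩
  refine Finset.mem_insert_of_mem (Finset.mem_biUnion.mpr ⟨u, hu, ?_⟩)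
  exact List.mem_toFinset.mpr (List.mem_map.mpr ⟨L', (List.mem_inits _ _).mpr hL', rfl⟩)

theorem exists_mem_commensurator_eqOn {α : Type*} [Finite α]
    (g : freeGroupCayleyTree α ≃g freeGroupCayleyTree α) (I : Finset (FreeGroup α)) :
    ∃ h ∈ Subgroup.Commensurable.commensurator (freeGroupLeftAction α).range,
      ∀ u ∈ I, h u = g u := by
  obtain ⟨B, h1, hB⟩ := exists_prefixClosed I
  obtain ⟨σ, hg, hσ⟩ := exists_localPerm g
  obtain ⟨D, hperm, hstep⟩ := exists_relabeling_extending B σ hσ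
  -- `D.aut` fixes the identity, so the translation by `g 1` is needed.
  refine ⟨freeGroupLeftAction α (g 1) * D.aut (σ 1, ⟨1, h1⟩),
    mul_mem (leftAction_mem_commensurator _) (D.aut_mem_commensurator _), fun u hu => ?_⟩
  obtain ⟨L, rfl, hL⟩ := hB u hu
  change g 1 * D.relabel (σ 1, ⟨1, h1⟩) (FreeGroup.mk L) = g (FreeGroup.mk L)
  suffices D.point (σ 1, ⟨1, h1⟩) (FreeGroup.mk L) =
      (σ (FreeGroup.mk L), ⟨FreeGroup.mk L, hL L List.prefix_rfl⟩) ∧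
      g 1 * D.relabel (σ 1, ⟨1, h1⟩) (FreeGroup.mk L) = g (FreeGroup.mk L) from this.2
  clear hu
  induction L using List.reverseRecOn with
  | nil =>
    simp only [← FreeGroup.one_eq_mk, Relabeling.point_one, Relabeling.relabel_one, mul_one,
      and_self]
  | append_singleton L s ih =>
    obtain ⟨ihp, ihr⟩ := ih fun L' h => hL L' (h.trans (List.prefix_append L [s]))
    have hmem := hL _ List.prefix_rfl
    simp only [mk_append_singleton] at hmem ⊢
    rw [Relabeling.point_mul_letter, Relabeling.relabel_mul_letter, ihp, hperm, ← mul_assoc, ihr,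
      hg]
    exact ⟨hstep ⟨FreeGroup.mk L, _⟩ s hmem, rfl⟩

theorem SimpleGraph.dense_of_forall_finset_eqOn {V : Type*} {G : SimpleGraph V}
    {S : Set (G ≃g G)} (h : ∀ (g : G ≃g G) (I : Finset V), ∃ f ∈ S, ∀ v ∈ I, f v = g v) :
    Dense S := by
  intro g
  rw [mem_closure_iff]
  rintro _ ⟨W, hW, rfl⟩ hg
  obtain ⟨I, u, hu, hIW⟩ := (@isOpen_pi_iff V (fun _ => V) (fun _ => ⊥) W).mp hW _ hg
  obtain ⟨f, hf, hfg⟩ := h g I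
  refine ⟨f, hIW fun v hv => ?_, hf⟩
  change f v ∈ u v
  rw [hfg v hv]
  exact (hu v hv).2

theorem mainTheorem7 :
    Dense ((Subgroup.Commensurable.commensurator (freeGroupLeftAction (Fin 3)).range :
        Subgroup (freeGroupCayleyTree (Fin 3) ≃g freeGroupCayleyTree (Fin 3))) :
      Set (freeGroupCayleyTree (Fin 3) ≃g freeGroupCayleyTree (Fin 3))) := by
  exact SimpleGraph.dense_of_forall_finset_eqOn exists_mem_commensurator_eqOn
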